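/- All spaces are Tychonoff (completely regular and Hausdorff). For spaces $X$ and $Y$, let $C_p(X,Y)$ be the set of continuous maps $X\to Y$ with the topology of pointwise convergence, and $C_p(X)=C_p(X,\mathbb R)$. A function $f:X\to\mathbb R$ is $k$-continuous if its restriction to every compact subset of $X$ is continuous, and $X$ is a $k_{\mathbb R}$-space if every $k$-continuous function $f:X\to\mathbb R$ is continuous. Let $P(\beta X)$ be the set of regular Borel probability measures on the Stone–Čech compactification $\beta X$; each $\mu\in P(\beta X)$ acts on $C_p(X,[-1,1])$ by $\mu(f)=\int_{\beta X}\beta f\,d\mu$, where $\beta f:\beta X\to[-1,1]$ is the continuous extension of $f$. Put $$P_\kappa(X)=\{\mu\in P(\beta X):\mu\text{ is }k\text{-continuous on }C_p(X,[-1,1])\},$$ $$P_d(X)=\{\mu\in P(\beta X):\mu(A)=1\text{ for some countable }A\subseteq X\}.$$ **Proposition.** Let $X$ be a Tychonoff space such that $C_p(X)$ is a $k_{\mathbb R}$-space. Then: 1. $X$ has Sakai's property $(\kappa)$: every sequence $(A_n)_{n\in\mathbb N}$ of pairwise disjoint finite subsets of $X$ has a subsequence $(A_{n_j})_{j\in\mathbb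 N}$ for which there are open sets $U_j\supseteq A_{n_j}$ such that each point of $X$ belongs to $U_j$ for only finitely many $j$; 2. $X$ is universal $\kappa$-measure zero: $P_\kappa(X)=P_d(X)$; 3. $X$ is a $\kappa$-space: $X$ is homeomorphic to a closed subspace of $C_p(Y)$ for some (Tychonoff) $k_{\mathbb R}$-space $Y$; 4. every compact subset $K$ of $X$ is scattered: every nonempty subset of $K$ has a relatively isolated point. -/

import Mathlib

open Set Topology MeasureTheory

universe u v

/-- `C_p(X, Y)`: the continuous maps `X → Y` with the topology of pointwise convergence, that is,
as a subspace of the product `X → Y`. -/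
abbrev Cp (X : Type u) (Y : Type v) [TopologicalSpace X] [TopologicalSpace Y] : Type (max u v) :=
  {f : X → Y // Continuous f}

/-- `f` is `k`-continuous if its restriction to every compact set is continuous. -/
def KContinuous {X : Type u} [TopologicalSpace X] (f : X → ℝ) : Prop :=
  ∀ K : Set X, IsCompact K → ContinuousOn f K

/-- The defining property of a `k_ℝ`-space. -/
def IsKRSpace (X : Type u) [TopologicalSpace X] : Prop :=
  ∀ f : X → ℝ, KContinuous f → Continuous f

/-- An indexed family is point-finite if each point lies in `A i` for only finitely many `i`. -/
def PointFinite {ι : Type v} {X : Type u} (A : ι → Set X) : Prop :=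
  ∀ x, {i | x ∈ A i}.Finite

/-- A family is strongly point-finite if it has a point-finite open expansion. -/
def StronglyPointFinite {ι : Type v} {X : Type u} [TopologicalSpace X] (A : ι → Set X) : Prop :=
  ∃ U : ι → Set X, (∀ i, IsOpen (U i) ∧ A i ⊆ U i) ∧ PointFinite U

/-- Sakai's property `(κ)`: every pairwise disjoint sequence of finite sets has a strongly
point-finite subsequence. -/
def PropertyKappa (X : Type u) [TopologicalSpace X] : Prop :=
  ∀ A : ℕ → Set X, (∀ n, (A n).Finite) → (Pairwise fun m n => Disjoint (A m) (A n)) →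
    ∃ φ : ℕ → ℕ, StrictMono φ ∧ StronglyPointFinite (A ∘ φ)

/-- The Stone-Čech compactification carries its Borel `σ`-algebra. -/
instance instMeasurableSpaceStoneCech (X : Type u) [TopologicalSpace X] :
    MeasurableSpace (StoneCech X) :=
  borel (StoneCech X)

instance instBorelSpaceStoneCech (X : Type u) [TopologicalSpace X] : BorelSpace (StoneCech X) :=
  ⟨rfl⟩

/-- `P(βX)`: the regular Borel probability measures on `βX`. -/
def ProbBeta (X : Type u) [TopologicalSpace X] : Set (Measure (StoneCech X)) :=
  {μ | IsProbabilityMeasure μ ∧ μ.Regular}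

/-- `P_d(X)`: the measures in `P(βX)` concentrated on a countable subset of `X`. -/
def ProbDiscrete (X : Type u) [TopologicalSpace X] : Set (Measure (StoneCech X)) :=
  {μ | μ ∈ ProbBeta X ∧ ∃ A : Set X, A.Countable ∧ μ (stoneCechUnit '' A) = 1}

/-- A measure on `βX` as a function on `C_p(X, [-1,1])`: `f` is sent to the integral of its
continuous extension `βf : βX → [-1,1]`. -/
noncomputable def evalOnCp {X : Type u} [TopologicalSpace X] (μ : Measure (StoneCech X))
    (f : Cp X (Icc (-1 : ℝ) 1)) : ℝ :=
  ∫ z, ((stoneCechExtend f.2 z : Icc (-1 : ℝ) 1) : ℝ) ∂μ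

/-- `P_κ(X)`: the measures in `P(βX)` that are `k`-continuous on `C_p(X, [-1,1])`. -/
def ProbKappa (X : Type u) [TopologicalSpace X] : Set (Measure (StoneCech X)) :=
  {μ | μ ∈ ProbBeta X ∧ KContinuous (evalOnCp μ)}

/-- `X` is universal `κ`-measure zero if `P_κ(X) = P_d(X)`. -/
def IsUniversalKappaMeasureZero (X : Type u) [TopologicalSpace X] : Prop :=
  ProbKappa X = ProbDiscrete X

/-- `X` is a `κ`-space if it is homeomorphic to a closed subspace of `C_p(Y)` for some Tychonoff
`k_ℝ`-space `Y`. -/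
def IsKappaSpace (X : Type u) [TopologicalSpace X] : Prop :=
  ∃ (Y : Type u) (_ : TopologicalSpace Y), T35Space Y ∧ IsKRSpace Y ∧
    ∃ e : X → Cp Y ℝ, IsClosedEmbedding e

/-- A subset is scattered if each of its nonempty subsets has a relatively isolated point. -/
def IsScatteredSet {X : Type u} [TopologicalSpace X] (S : Set X) : Prop :=
  ∀ A : Set X, A ⊆ S → A.Nonempty → ∃ x ∈ A, ∃ U : Set X, IsOpen U ∧ U ∩ A = {x}

/-! A continuous function on a `C_p` space is controlled near each point by finitely many
coordinates; the `k_ℝ`-hypothesis serves to make suitable functions continuous. For `(κ)`, a bad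
sequence yields a sum of bumps on `C_p(X)` that is finite on each compact set, yet takes values at
least 1 arbitrarily near zero. For measures, the hypothesis passes to `C_p(X, [-1,1])`; continuity
of `μ` at zero puts all but `ε` of its mass on a finite subset of `X`. For the `κ`-space claim, `Y =
C_p(X)`: evaluations form a closed copy of `X` in `C_p(C_p(X))`. Scatteredness needs only `(κ)`: a
set without isolated points gives a Cantor scheme, whose levels yield disjoint finite sets that no
point-finite open family can expand, by Baire. -/

/-- Every neighbourhood of `f` in `C_p(X, Y)` contains all maps agreeing with `f` on some finite
set. -/
theorem Cp.exists_finite_eqOn_mem {X : Type u} {Y : Type v} [TopologicalSpace X]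
    [TopologicalSpace Y] {f : Cp X Y} {s : Set (Cp X Y)} (hs : s ∈ 𝓝 f) :
    ∃ F : Set X, F.Finite ∧ ∀ g : Cp X Y, EqOn g.1 f.1 F → g ∈ s := by
  obtain ⟨u, hu, hus⟩ := (mem_nhds_induced _ _ _).1 hs
  rw [nhds_pi, Filter.mem_pi] at hu
  obtain ⟨I, hI, t, ht, hsub⟩ := hu
  refine ⟨I, hI, fun g hg => hus (hsub fun i hi => ?_)⟩
  rw [hg hi]
  exact mem_of_mem_nhds (ht i)

theorem Cp.continuous_eval {X : Type u} {Y : Type v} [TopologicalSpace X]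
    [TopologicalSpace Y] (x : X) : Continuous fun f : Cp X Y => f.1 x :=
  (continuous_apply x).comp continuous_subtype_val

/-- In a Tychonoff space disjoint finite sets are separated by a continuous function. -/
theorem Cp.exists_eqOn_zero_eqOn_one {X : Type u} [TopologicalSpace X] [T35Space X] {F A : Set X}
    (hF : F.Finite) (hA : A.Finite) (h : Disjoint F A) :
    ∃ f : Cp X ℝ, EqOn f.1 0 F ∧ EqOn f.1 1 A := by
  obtain ⟨g, h0, h1, -⟩ := exists_continuous_zero_one_of_isClosed
    (hF.image (stoneCechUnit (α := X))).isClosed (hA.image stoneCechUnit).isClosed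
    ((disjoint_image_iff injective_stoneCechUnit_of_t35Space).2 h)
  exact ⟨⟨g ∘ stoneCechUnit, g.continuous.comp continuous_stoneCechUnit⟩,
    fun x hx => h0 (mem_image_of_mem _ hx), fun x hx => h1 (mem_image_of_mem _ hx)⟩

/-! ### The closed embedding into the double function space -/

/-- The canonical map of `X` into `C_p(C_p(X))`. -/
def Cp.eval {X : Type u} [TopologicalSpace X] (x : X) : Cp (Cp X ℝ) ℝ :=
  ⟨fun f => f.1 x, Cp.continuous_eval x⟩

theorem Cp.isInducing_eval {X : Type u} [TopologicalSpace X] [T35Space X] :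
    IsInducing (Cp.eval (X := X)) := by
  have hc : Continuous (Cp.eval (X := X)) :=
    Continuous.subtype_mk (continuous_pi fun f => f.2) _
  refine isInducing_iff_nhds.2 fun x => le_antisymm hc.continuousAt.le_comap fun s hs => ?_
  obtain ⟨f, hf, hfx, hf1⟩ := CompletelyRegularSpace.completely_regular x (interior s)ᶜ
    isOpen_interior.isClosed_compl (by simpa [mem_interior_iff_mem_nhds] using hs)
  let f' : Cp X ℝ := ⟨fun x => f x, continuous_subtype_val.comp hf⟩
  refine Filter.mem_comap.2 ⟨{ψ | ψ.1 f' < 1}, ?_, fun y hy => ?_⟩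
  · exact (isOpen_lt (Cp.continuous_eval f') continuous_const).mem_nhds (by simp [Cp.eval, f', hfx])
  · by_contra hys
    have : f y = 1 := hf1 fun h => hys (interior_subset h)
    simp [Cp.eval, f', this] at hy

/-- A limit `φ` of evaluations respects polynomial identities. Were it no evaluation, a product of
functions `f x - f x (x)` over a finite `F` that controls `φ` at zero would vanish on `F` but, once
normalized, have `φ`-value 1. -/
theorem Cp.isClosed_range_eval {X : Type u} [TopologicalSpace X] :
    IsClosed (range (Cp.eval (X := X))) := by
  refine isClosed_of_closure_subset fun φ hφ => ?_
  have key : ∀ p : Cp (Cp X ℝ) ℝ → Prop, IsClosed {ψ | p ψ} → (∀ x, p (Cp.eval x)) → p φ :=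
    fun p hp hx => closure_minimal (range_subset_iff.2 hx) hp hφ
  have h0 : φ.1 ⟨0, continuous_const⟩ = 0 :=
    key (fun ψ => ψ.1 ⟨0, continuous_const⟩ = 0)
      (isClosed_eq (Cp.continuous_eval _) continuous_const) fun x => rfl
  obtain ⟨F, hF, hFφ⟩ := Cp.exists_finite_eqOn_mem
    (s := {h : Cp X ℝ | φ.1 h < 1}) (f := ⟨0, continuous_const⟩)
    ((isOpen_lt φ.2 continuous_const).mem_nhds (by simp [h0]))
  by_contra hne
  have hsep : ∀ x : X, ∃ f : Cp X ℝ, φ.1 f - f.1 x ≠ 0 := fun x => by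
    by_contra! h
    exact hne ⟨x, Subtype.ext (funext fun f => (sub_eq_zero.1 (h f)).symm)⟩
  choose f hf using hsep
  let P : Cp (Cp X ℝ) ℝ → ℝ := fun ψ => ∏ x ∈ hF.toFinset, (ψ.1 (f x) - (f x).1 x)
  have hP : Continuous P :=
    continuous_finsetProd _ fun x _ => (Cp.continuous_eval (f x)).sub continuous_const
  have hPφ : P φ ≠ 0 := Finset.prod_ne_zero_iff.2 fun x _ => hf x
  let g : Cp X ℝ := ⟨fun y => (P φ)⁻¹ * ∏ x ∈ hF.toFinset, ((f x).1 y - (f x).1 x),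
    continuous_const.mul (continuous_finsetProd _ fun x _ => (f x).2.sub continuous_const)⟩
  have hg : φ.1 g = (P φ)⁻¹ * P φ :=
    key (fun ψ => ψ.1 g = (P φ)⁻¹ * P ψ)
      (isClosed_eq (Cp.continuous_eval _) (continuous_const.mul hP)) fun x => rfl
  have hlt : φ.1 g < 1 := hFφ g fun y hy => by
    simp only [g, Pi.zero_apply, mul_eq_zero]
    exact Or.inr (Finset.prod_eq_zero (hF.mem_toFinset.2 hy) (sub_self _))
  rw [hg, inv_mul_cancel₀ hPφ] at hlt
  exact lt_irrefl _ hlt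

theorem IsKRSpace.isKappaSpace {X : Type u} [TopologicalSpace X] [T35Space X]
    (hX : IsKRSpace (Cp X ℝ)) : IsKappaSpace X :=
  ⟨Cp X ℝ, inferInstance, inferInstance, hX, Cp.eval,
    Cp.isInducing_eval.isEmbedding, Cp.isClosed_range_eval⟩

/-! ### Property (κ) -/

/-- If `C_p(X)` is a `k_ℝ`-space, then a disjoint sequence of nonempty finite sets has a strongly
point-finite subsequence: otherwise `∑ᶠ n, c n` below would be a `k`-continuous function on `C_p(X)`
that is discontinuous at zero. -/
theorem IsKRSpace.exists_stronglyPointFinite {X : Type u} [TopologicalSpace X] [T35Space X]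
    (hX : IsKRSpace (Cp X ℝ)) (A : ℕ → Set X) (hA : ∀ n, (A n).Finite)
    (hd : Pairwise fun m n => Disjoint (A m) (A n)) (hne : ∀ n, (A n).Nonempty) :
    ∃ φ : ℕ → ℕ, StrictMono φ ∧ StronglyPointFinite (A ∘ φ) := by
  by_contra hcon
  let c : ℕ → Cp X ℝ → ℝ := fun n f => ∏ x ∈ (hA n).toFinset, max 0 (min 1 (f.1 x - n))
  have hc : ∀ n, Continuous (c n) := fun n => continuous_finsetProd _ fun x _ =>
    continuous_const.max (continuous_const.min ((Cp.continuous_eval x).sub continuous_const))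
  have hc0 : ∀ n f, 0 ≤ c n f := fun n f => Finset.prod_nonneg fun x _ => le_max_left _ _
  have hcpos : ∀ n f, c n f ≠ 0 → ∀ x ∈ A n, (n : ℝ) < f.1 x := fun n f h x hx => by
    by_contra! hle
    refine Finset.prod_ne_zero_iff.1 h x ((hA n).mem_toFinset.2 hx) (max_eq_left ?_)
    exact (min_le_right _ _).trans (sub_nonpos.2 hle)
  have hfin : ∀ K : Set (Cp X ℝ), IsCompact K → {n | ∃ f ∈ K, c n f ≠ 0}.Finite := by
    intro K hK
    by_contra hinf
    have hinf : {n | ∃ f ∈ K, c n f ≠ 0}.Infinite := hinf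
    have hmem := Nat.nth_mem_of_infinite hinf
    have hmono := Nat.nth_strictMono hinf
    set φ := Nat.nth (· ∈ {n | ∃ f ∈ K, c n f ≠ 0})
    choose f hfK hf using hmem
    refine hcon ⟨φ, hmono, fun j => {x | (φ j : ℝ) < (f j).1 x},
      fun j => ⟨isOpen_lt continuous_const (f j).2, hcpos _ _ (hf j)⟩, fun x => ?_⟩
    -- Compactness of `K` bounds all values `f j x`, while the thresholds `φ j` tend to infinity.
    obtain ⟨b, hb⟩ := (hK.image (Cp.continuous_eval x)).bddAbove
    obtain ⟨N, hN⟩ := exists_nat_ge b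
    refine (finite_Iio N).subset fun j hj => ?_
    have h1 : (f j).1 x ≤ b := hb (mem_image_of_mem _ (hfK j))
    have h2 : (φ j : ℝ) < N := hj.trans_le (h1.trans hN)
    exact (hmono.le_apply (x := j)).trans_lt (by exact_mod_cast h2)
  have hsum : ∀ K : Set (Cp X ℝ), ∀ hK : IsCompact K, ∀ f ∈ K,
      ∑ᶠ n, c n f = ∑ n ∈ (hfin K hK).toFinset, c n f := fun K hK f hf =>
    finsum_eq_sum_of_support_subset _ fun n hn => (hfin K hK).mem_toFinset.2 ⟨f, hf, hn⟩
  have hcont : Continuous fun f => ∑ᶠ n, c n f := hX _ fun K hK =>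
    (continuous_finsetSum _ fun n _ => hc n).continuousOn.congr (hsum K hK)
  have h0 : ∑ᶠ n, c n ⟨0, continuous_const⟩ = 0 := by
    refine finsum_eq_zero_of_forall_eq_zero fun n => by_contra fun h => ?_
    obtain ⟨x, hx⟩ := hne n
    exact (hcpos n _ h x hx).not_ge (by simp)
  obtain ⟨F, hF, hFs⟩ := Cp.exists_finite_eqOn_mem
    (s := {f : Cp X ℝ | ∑ᶠ n, c n f < 1}) (f := ⟨0, continuous_const⟩)
    ((isOpen_lt hcont continuous_const).mem_nhds (by simp [h0]))
  obtain ⟨n, hn⟩ : ∃ n, Disjoint F (A n) := by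
    by_contra! h
    simp only [not_disjoint_iff] at h
    choose p hpF hpA using h
    have hinj : Function.Injective p := fun m n hmn => by_contra fun hne =>
      disjoint_left.1 (hd hne) (hpA m) (hmn ▸ hpA n)
    exact infinite_range_of_injective hinj (hF.subset (range_subset_iff.2 hpF))
  obtain ⟨g, hg0, hg1⟩ := Cp.exists_eqOn_zero_eqOn_one hF (hA n) hn
  -- The height `n + 1` makes every factor of `c n f` equal to 1.
  let f : Cp X ℝ := ⟨fun x => (n + 1) * g.1 x, continuous_const.mul g.2⟩
  have hf1 : c n f = 1 := Finset.prod_eq_one fun x hx => by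
    have : g.1 x = 1 := hg1 ((hA n).mem_toFinset.1 hx)
    simp [f, this]
  have hlt : ∑ᶠ n, c n f < 1 := hFs f fun x hx => by
    have : g.1 x = 0 := hg0 hx
    simp [f, this]
  rw [hsum _ isCompact_singleton f rfl] at hlt
  refine hlt.not_ge (hf1 ▸ Finset.single_le_sum (f := fun n => c n f) (fun m _ => hc0 m f) ?_)
  simp [hf1]

theorem IsKRSpace.propertyKappa {X : Type u} [TopologicalSpace X] [T35Space X]
    (hX : IsKRSpace (Cp X ℝ)) : PropertyKappa X := by
  intro A hA hd
  -- Empty sets are treated apart, since their bump, an empty product, would be the constant 1.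
  by_cases hinf : {n | A n = ∅}.Infinite
  · refine ⟨_, Nat.nth_strictMono hinf, fun _ => ∅, fun i => ⟨isOpen_empty, ?_⟩, fun x => by simp⟩
    exact (Nat.nth_mem_of_infinite hinf i).subset
  · obtain ⟨N, hN⟩ := (not_infinite.1 hinf).bddAbove
    have hmono : StrictMono fun n => n + (N + 1) := fun m n h => Nat.add_lt_add_right h _
    obtain ⟨φ, hφ, h⟩ := hX.exists_stronglyPointFinite (fun n => A (n + (N + 1)))
      (fun n => hA _) (fun m n h => hd (hmono.injective.ne h)) fun n => by
        rw [nonempty_iff_ne_empty]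
        intro h
        have : n + (N + 1) ≤ N := hN h
        omega
    exact ⟨_, hmono.comp hφ, h⟩

/-! ### Measures -/

/-- `C_p(X, [-1,1])` is a retract of `C_p(X)` and hence inherits the `k_ℝ`-property. -/
theorem IsKRSpace.cp_Icc {X : Type u} [TopologicalSpace X] (hX : IsKRSpace (Cp X ℝ)) :
    IsKRSpace (Cp X (Icc (-1 : ℝ) 1)) := by
  intro φ hφ
  let i : Cp X (Icc (-1 : ℝ) 1) → Cp X ℝ := fun f => ⟨fun x => f.1 x, continuous_subtype_val.comp f.2⟩
  have h11 : (-1 : ℝ) ≤ 1 := by norm_num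
  let r : Cp X ℝ → Cp X (Icc (-1 : ℝ) 1) :=
    fun f => ⟨fun x => projIcc (-1) 1 h11 (f.1 x), continuous_projIcc.comp f.2⟩
  have hi : Continuous i := Continuous.subtype_mk (continuous_pi fun x =>
    continuous_subtype_val.comp (Cp.continuous_eval x)) _
  have hr : Continuous r := Continuous.subtype_mk (continuous_pi fun x =>
    continuous_projIcc.comp (Cp.continuous_eval x)) _
  have hri : ∀ f, r (i f) = f := fun f => Subtype.ext (funext fun x => projIcc_val h11 _)
  have h : Continuous (φ ∘ r) := hX _ fun K hK =>
    (hφ _ (hK.image hr)).comp hr.continuousOn (mapsTo_image r K)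
  have := h.comp hi
  rwa [show (φ ∘ r) ∘ i = φ from funext fun f => congrArg φ (hri f)] at this

theorem evalOnCp_comp_stoneCechUnit {X : Type u} [TopologicalSpace X] (μ : Measure (StoneCech X))
    {g : StoneCech X → Icc (-1 : ℝ) 1} (hg : Continuous g) :
    evalOnCp μ ⟨g ∘ stoneCechUnit, hg.comp continuous_stoneCechUnit⟩ = ∫ z, (g z : ℝ) ∂μ := by
  rw [evalOnCp, stoneCech_hom_ext (continuous_stoneCechExtend _) hg (stoneCechExtend_extends _)]

/-- A measure concentrated on a countable subset of `X` is continuous on `C_p(X, [-1,1])`. -/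
theorem continuous_evalOnCp_of_countable {X : Type u} [TopologicalSpace X]
    {μ : Measure (StoneCech X)} [IsProbabilityMeasure μ] {A : Set X} (hA : A.Countable)
    (h : μ (stoneCechUnit '' A) = 1) : Continuous (evalOnCp μ) := by
  set S : Set (StoneCech X) := stoneCechUnit '' A
  have hS : S.Countable := hA.image _
  have hSm : MeasurableSet S := hS.measurableSet
  have hint : ∀ f : Cp X (Icc (-1 : ℝ) 1),
      Integrable (fun z => ((stoneCechExtend f.2 z : Icc (-1 : ℝ) 1) : ℝ)) μ := fun f =>
    Integrable.of_bound (continuous_subtype_val.comp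
      (continuous_stoneCechExtend f.2)).measurable.aestronglyMeasurable 1
      (Filter.Eventually.of_forall fun z => abs_le.2 (stoneCechExtend f.2 z).2)
  have hsum : Summable fun s : S => μ.real {(s : StoneCech X)} := by
    have := hS.to_subtype
    refine ENNReal.summable_toReal (ne_top_of_le_ne_top (measure_ne_top μ _)
      (tsum_meas_le_meas_iUnion_of_disjoint μ (fun s : S => measurableSet_singleton s.1) ?_))
    exact fun s t hst => disjoint_singleton.2 (Subtype.coe_injective.ne hst)
  -- The integral is a sum of point evaluations, dominated by the summable point masses.
  have heq : evalOnCp μ = fun f => ∑' s : S,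
      μ.real {(s : StoneCech X)} • ((stoneCechExtend f.2 s : Icc (-1 : ℝ) 1) : ℝ) := by
    funext f
    rw [← setIntegral_countable _ hS (hint f).integrableOn, evalOnCp,
      Measure.restrict_eq_self_of_ae_mem]
    exact (prob_compl_eq_zero_iff hSm).2 h
  rw [heq]
  refine continuous_tsum (fun s => ?_) hsum fun s f => ?_
  · obtain ⟨-, x, -, rfl⟩ := s
    have : ∀ f : Cp X (Icc (-1 : ℝ) 1), stoneCechExtend f.2 (stoneCechUnit x) = f.1 x :=
      fun f => congrFun (stoneCechExtend_extends f.2) x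
    simp only [this]
    have hx : Continuous fun f : Cp X (Icc (-1 : ℝ) 1) => (f.1 x : ℝ) :=
      continuous_subtype_val.comp (Cp.continuous_eval x)
    exact hx.const_smul (μ.real {stoneCechUnit x})
  · rw [norm_smul, Real.norm_of_nonneg measureReal_nonneg]
    exact mul_le_of_le_one_right measureReal_nonneg (abs_le.2 (stoneCechExtend f.2 s).2)

/-- If integrals of functions vanishing on a finite set are small, then so is the measure of the
complement of that set. -/
theorem measure_compl_le_of_evalOnCp_lt {X : Type u} [TopologicalSpace X]
    {μ : Measure (StoneCech X)} [IsProbabilityMeasure μ] [μ.Regular] {F : Set X} (hF : F.Finite)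
    {ε : ℝ} (h : ∀ f : Cp X (Icc (-1 : ℝ) 1), (∀ x ∈ F, (f.1 x : ℝ) = 0) → evalOnCp μ f < ε) :
    μ (stoneCechUnit '' F)ᶜ ≤ ENNReal.ofReal ε := by
  have hcl := (hF.image (stoneCechUnit (α := X))).isClosed
  rw [hcl.isOpen_compl.measure_eq_iSup_isCompact]
  refine iSup_le fun K => iSup_le fun hKF => iSup_le fun hK => ?_
  obtain ⟨g, h0, h1, h01⟩ := exists_continuous_zero_one_of_isClosed hcl hK.isClosed
    (disjoint_compl_right.mono_right hKF)
  let g' : StoneCech X → Icc (-1 : ℝ) 1 :=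
    fun z => ⟨g z, (by norm_num : (-1 : ℝ) ≤ 0).trans (h01 z).1, (h01 z).2⟩
  have hg' : Continuous g' := g.continuous.subtype_mk _
  have hlt := h ⟨g' ∘ stoneCechUnit, hg'.comp continuous_stoneCechUnit⟩
    fun x hx => h0 (mem_image_of_mem _ hx)
  rw [evalOnCp_comp_stoneCechUnit μ hg'] at hlt
  have hint : Integrable (fun z => (g' z : ℝ)) μ :=
    Integrable.of_bound g.continuous.measurable.aestronglyMeasurable 1
      (Filter.Eventually.of_forall fun z => abs_le.2 (g' z).2)
  have hle : μ.real K ≤ ∫ z, (g' z : ℝ) ∂μ := by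
    rw [← integral_indicator_one hK.measurableSet]
    refine integral_mono ((integrable_const 1).indicator hK.measurableSet) hint fun z => ?_
    by_cases hz : z ∈ K
    · simpa [hz, g'] using (h1 hz).ge
    · simpa [hz, g'] using (h01 z).1
  rw [← ofReal_measureReal]
  exact ENNReal.ofReal_le_ofReal (hle.trans hlt.le)

/-- Continuity at zero with tolerance `1 / (n + 1)` gives a finite set missing at most that much
mass; the union over `n` has full measure. -/
theorem exists_countable_of_continuous_evalOnCp {X : Type u} [TopologicalSpace X]
    {μ : Measure (StoneCech X)} [IsProbabilityMeasure μ] [μ.Regular]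
    (h : Continuous (evalOnCp μ)) : ∃ A : Set X, A.Countable ∧ μ (stoneCechUnit '' A) = 1 := by
  have hex : ∀ n : ℕ, ∃ F : Set X, F.Finite ∧
      μ (stoneCechUnit '' F)ᶜ ≤ ENNReal.ofReal (1 / ((n : ℝ) + 1)) := fun n => by
    let z : Icc (-1 : ℝ) 1 := ⟨0, by norm_num, by norm_num⟩
    have hz : evalOnCp μ ⟨fun _ => z, continuous_const⟩ = 0 := by
      exact (evalOnCp_comp_stoneCechUnit μ (g := fun _ => z) continuous_const).trans (by simp [z])
    obtain ⟨F, hF, hFs⟩ := Cp.exists_finite_eqOn_mem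
      (s := {f | evalOnCp μ f < 1 / ((n : ℝ) + 1)}) (f := ⟨fun _ => z, continuous_const⟩)
      ((isOpen_lt h continuous_const).mem_nhds (hz.trans_lt (by positivity)))
    exact ⟨F, hF, measure_compl_le_of_evalOnCp_lt hF fun f hf =>
      hFs f fun x hx => Subtype.ext (hf x hx)⟩
  choose F hF hFμ using hex
  have hA : (⋃ n, F n).Countable := countable_iUnion fun n => (hF n).countable
  refine ⟨_, hA, (prob_compl_eq_zero_iff (hA.image _).measurableSet).1 ?_⟩
  have hlim : Filter.Tendsto (fun n : ℕ => ENNReal.ofReal (1 / ((n : ℝ) + 1))) Filter.atTop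
      (𝓝 0) := by
    simpa using ENNReal.tendsto_ofReal tendsto_one_div_add_atTop_nhds_zero_nat
  exact le_zero_iff.1 (ge_of_tendsto' hlim fun n => (measure_mono
    (compl_subset_compl.2 (image_mono (subset_iUnion F n)))).trans (hFμ n))

theorem IsKRSpace.isUniversalKappaMeasureZero {X : Type u} [TopologicalSpace X]
    (hX : IsKRSpace (Cp X ℝ)) : IsUniversalKappaMeasureZero X := by
  refine Subset.antisymm (fun μ hμ => ?_) fun μ hμ => ?_
  · obtain ⟨hP, hk⟩ := hμ
    have := hP.1
    have := hP.2
    exact ⟨hP, exists_countable_of_continuous_evalOnCp (hX.cp_Icc _ hk)⟩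
  · obtain ⟨hP, A, hA, h⟩ := hμ
    have := hP.1
    exact ⟨hP, fun K _ => (continuous_evalOnCp_of_countable hA h).continuousOn⟩

/-! ### Scattered compact sets -/

/-- A set without isolated points supports a Cantor scheme of closed sets. -/
theorem exists_cantorScheme_isClosed {X : Type u} [TopologicalSpace X] [T3Space X] {A : Set X}
    (hne : A.Nonempty) (hA : ∀ x ∈ A, ∀ U, IsOpen U → x ∈ U → ∃ y ∈ U ∩ A, y ≠ x) :
    ∃ D : List Bool → Set X, (∀ s, IsClosed (D s)) ∧ (∀ s, (D s ∩ A).Nonempty) ∧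
      (∀ s b, D (b :: s) ⊆ D s) ∧ ∀ s, Disjoint (D (true :: s)) (D (false :: s)) := by
  have hreg : ∀ (x : X) (U : Set X), IsOpen U → x ∈ U →
      ∃ V, IsOpen V ∧ x ∈ V ∧ closure V ⊆ U := fun x U hU hx => by
    obtain ⟨V, hxV, hV, hVU⟩ := exists_mem_nhds_isClosed_subset (hU.mem_nhds hx)
    exact ⟨interior V, isOpen_interior, mem_interior_iff_mem_nhds.2 hxV,
      (closure_minimal interior_subset hV).trans hVU⟩
  let T := {U : Set X // IsOpen U ∧ (U ∩ A).Nonempty}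
  have hstep : ∀ U : T, ∃ V : Bool → T, (∀ b, closure (V b).1 ⊆ U.1) ∧
      Disjoint (closure (V true).1) (closure (V false).1) := by
    rintro ⟨U, hU, x, hxU, hxA⟩
    obtain ⟨y, ⟨hyU, hyA⟩, hyx⟩ := hA x hxA U hU hxU
    obtain ⟨V, W, hV, hW, hyV, hxW, hVW⟩ := t2_separation hyx
    obtain ⟨V', hV', hyV', hcV⟩ := hreg y (U ∩ V) (hU.inter hV) ⟨hyU, hyV⟩
    obtain ⟨W', hW', hxW', hcW⟩ := hreg x (U ∩ W) (hU.inter hW) ⟨hxU, hxW⟩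
    refine ⟨fun b => bif b then ⟨V', hV', y, hyV', hyA⟩ else ⟨W', hW', x, hxW', hxA⟩, ?_, ?_⟩
    · rintro (_ | _)
      · exact fun z hz => (hcW hz).1
      · exact fun z hz => (hcV hz).1
    · exact hVW.mono (fun z hz => (hcV hz).2) fun z hz => (hcW hz).2
  choose V hVU hV using hstep
  let E : List Bool → T := fun s => s.rec ⟨univ, isOpen_univ, by simpa using hne⟩ fun b _ U => V U b
  refine ⟨fun s => closure (E s).1, fun s => isClosed_closure,
    fun s => (E s).2.2.mono (inter_subset_inter_left _ subset_closure),
    fun s b => (hVU (E s) b).trans subset_closure, fun s => hV (E s)⟩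

/-- Countably many infinite sets have a system of distinct representatives. -/
theorem exists_injective_forall_mem {ι : Type v} [Countable ι] [Nonempty ι] {X : Type u}
    {S : ι → Set X} (hS : ∀ i, (S i).Infinite) : ∃ p : ι → X, Function.Injective p ∧ ∀ i, p i ∈ S i := by
  obtain ⟨e, he⟩ := exists_surjective_nat ι
  choose pick hpick hnot using fun n (T : Finset X) => (hS (e n)).exists_notMem_finset T
  classical
  -- `Q n` collects the representatives chosen before stage `n`.
  let Q : ℕ → Finset X := fun n => n.rec ∅ fun n T => insert (pick n T) T
  have hQ : Monotone Q := monotone_nat_of_le_succ fun n => Finset.subset_insert _ _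
  have hlt : ∀ m n, m < n → pick m (Q m) ≠ pick n (Q n) := fun m n hmn h =>
    hnot n (Q n) (h ▸ hQ (Nat.succ_le_of_lt hmn) (Finset.mem_insert_self _ _))
  have hinj : Function.Injective fun n => pick n (Q n) := fun m n h => by
    rcases lt_trichotomy m n with hmn | hmn | hmn
    · exact absurd h (hlt m n hmn)
    · exact hmn
    · exact absurd h.symm (hlt n m hmn)
  refine ⟨_, hinj.comp (Function.injective_surjInv he), fun i => ?_⟩
  have := hpick (Function.surjInv he i) (Q (Function.surjInv he i))
  rwa [Function.surjInv_eq he] at this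

/-- A compact set meeting all members of a family of closed sets contains a minimal such closed
set. -/
theorem exists_minimal_isClosed_inter_nonempty {X : Type u} [TopologicalSpace X] [T2Space X]
    {ι : Type v} {K : Set X} (hK : IsCompact K) {D : ι → Set X} (hD : ∀ i, IsClosed (D i))
    (hKD : ∀ i, (K ∩ D i).Nonempty) :
    ∃ L ⊆ K, Minimal (fun L => IsClosed L ∧ L ⊆ K ∧ ∀ i, (L ∩ D i).Nonempty) L := by
  refine zorn_superset_nonempty {L | IsClosed L ∧ L ⊆ K ∧ ∀ i, (L ∩ D i).Nonempty} ?_ K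
    ⟨hK.isClosed, Subset.rfl, hKD⟩
  intro c hc hchain hcne
  refine ⟨⋂₀ c, ⟨isClosed_sInter fun L hL => (hc hL).1, ?_, fun i => ?_⟩,
    fun L hL => sInter_subset_of_mem hL⟩
  · obtain ⟨L, hL⟩ := hcne
    exact (sInter_subset_of_mem hL).trans (hc hL).2.1
  · have : Nonempty c := hcne.to_subtype
    have h := IsCompact.nonempty_iInter_of_directed_nonempty_isCompact_isClosed
      (fun L : c => L.1 ∩ D i) ?_ (fun L => (hc L.2).2.2 i)
      (fun L => (hK.of_isClosed_subset (hc L.2).1 (hc L.2).2.1).inter_right (hD i))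
      (fun L => (hc L.2).1.inter (hD i))
    · obtain ⟨x, hx⟩ := h
      simp only [mem_iInter, mem_inter_iff, Subtype.forall] at hx
      obtain ⟨L, hL⟩ := hcne
      exact ⟨x, fun L hL => (hx L hL).1, (hx L hL).2⟩
    · intro L M
      rcases hchain.total L.2 M.2 with h | h
      · exact ⟨L, Subset.rfl, inter_subset_inter_left _ h⟩
      · exact ⟨M, inter_subset_inter_left _ h, Subset.rfl⟩

theorem PropertyKappa.isScatteredSet {X : Type u} [TopologicalSpace X] [T3Space X]
    (hX : PropertyKappa X) {K : Set X} (hK : IsCompact K) : IsScatteredSet K := by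
  intro A hAK hAne
  by_contra! hiso
  obtain ⟨D, hDc, hDA, hDs, hDd⟩ := exists_cantorScheme_isClosed hAne (fun x hx U hU hxU => by
    by_contra! h
    exact hiso x hx U hU (Subset.antisymm h (singleton_subset_iff.2 ⟨hxU, hx⟩)))
  obtain ⟨L, hLK, hL, hmin⟩ := exists_minimal_isClosed_inter_nonempty hK hDc
    (fun s => (hDA s).mono fun x hx => ⟨hAK hx.2, hx.1⟩)
  have hLc : IsCompact L := hK.of_isClosed_subset hL.1 hLK
  -- A finite piece of least size would have a strictly smaller child, as its two children are
  -- disjoint and nonempty.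
  have hinf : ∀ s, (L ∩ D s).Infinite := by
    by_contra! h
    obtain ⟨s, hs, hsmin⟩ := exists_minimalFor_of_wellFoundedLT
      (fun s => (L ∩ D s).Finite) (fun s => (L ∩ D s).ncard) h
    have hsub : L ∩ D (true :: s) ⊂ L ∩ D s := by
      obtain ⟨y, hyL, hy⟩ := hL.2.2 (false :: s)
      exact (ssubset_iff_of_subset (inter_subset_inter_right _ (hDs s true))).2
        ⟨y, ⟨hyL, hDs s false hy⟩, fun h => disjoint_left.1 (hDd s) h.2 hy⟩
    have hlt := ncard_lt_ncard hsub hs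
    exact hlt.not_ge (hsmin (hs.subset hsub.subset) hlt.le)
  have happ : ∀ t s, D (t ++ s) ⊆ D s := fun t s => by
    induction t with
    | nil => exact Subset.rfl
    | cons b t ih => exact (hDs _ b).trans ih
  obtain ⟨p, hp, hpm⟩ := exists_injective_forall_mem hinf
  obtain ⟨φ, hφ, U, hU, hfin⟩ := hX (fun n => p '' {s | s.length = n})
    (fun n => (List.finite_length_eq Bool n).image p)
    (fun m n hmn => (disjoint_image_iff hp).2 (disjoint_left.2 fun s hm hn => hmn (hm.symm.trans hn)))
  have hdense : ∀ m, Dense ((↑) ⁻¹' ⋃ j ≥ m, U j : Set L) := by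
    intro m
    refine dense_iff_inter_open.2 ?_
    rintro _ ⟨V, hV, rfl⟩ ⟨x, hx⟩
    -- Otherwise `L \ V` would still meet every `D s`, against minimality: the pieces `L ∩ D s` form
    -- a π-base of `L`.
    obtain ⟨s, hs⟩ : ∃ s, L ∩ D s ⊆ V := by
      by_contra! h
      have := @hmin (L \ V) ⟨hL.1.sdiff hV, sdiff_subset.trans hLK, fun s => by
        obtain ⟨y, hy, hyV⟩ := not_subset.1 (h s)
        exact ⟨y, ⟨hy.1, hyV⟩, hy.2⟩⟩ sdiff_subset
      exact (this x.2).2 hx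
    let j := max m s.length
    have hj : s.length ≤ φ j := (le_max_right _ _).trans hφ.le_apply
    -- Only levels `φ j` are available, so `s` is extended to a descendant of that length.
    let t := List.replicate (φ j - s.length) true ++ s
    have ht : p t ∈ U j := (hU j).2 ⟨t, by simp [t, hj], rfl⟩
    refine ⟨⟨p t, (hpm t).1⟩, hs ⟨(hpm t).1, happ _ _ (hpm t).2⟩, ?_⟩
    exact mem_biUnion (le_max_left m s.length) ht
  have : CompactSpace L := isCompact_iff_compactSpace.1 hLc
  have : Nonempty L := ⟨⟨p [], (hpm []).1⟩⟩
  -- By Baire, some point of `L` lies in `U j` for infinitely many `j`.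
  obtain ⟨x, hx⟩ := (dense_iInter_of_isOpen_nat (fun m => IsOpen.preimage continuous_subtype_val
    (isOpen_biUnion fun j _ => (hU j).1)) hdense).nonempty
  refine (Nat.frequently_atTop_iff_infinite.1 ?_) (hfin x)
  refine Filter.frequently_atTop.2 fun m => ?_
  obtain ⟨j, hj, hxj⟩ := mem_iUnion₂.1 (mem_iInter.1 hx m)
  exact ⟨j, hj, hxj⟩

theorem proposition10p1 {X : Type u} [TopologicalSpace X] [T35Space X]
    (hX : IsKRSpace (Cp X ℝ)) :
    PropertyKappa X ∧ IsUniversalKappaMeasureZero X ∧ IsKappaSpace X ∧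
      ∀ K : Set X, IsCompact K → IsScatteredSet K :=
  ⟨hX.propertyKappa, hX.isUniversalKappaMeasureZero, hX.isKappaSpace,
    fun _ hK => hX.propertyKappa.isScatteredSet hK⟩
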